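/- **Setting.** Let $\mathbb F$ be an algebraically closed field of characteristic $0$, let $G$ be an abelian group, and let $\mathcal L=\bigoplus_{g\in G}\mathcal L_g$ be a $G$-graded finite-dimensional semisimple Lie algebra over $\mathbb F$. Let $V=V_\lambda$ be a finite-dimensional simple $\mathcal L$-module (of highest weight $\lambda$), with representation $\rho\colon U(\mathcal L)\to\mathrm{End}(V)$. A character $\chi\in\widehat G=\mathrm{Hom}(G,\mathbb F^\times)$ acts on $\mathcal L$ by the automorphism $\alpha_\chi$ with $\alpha_\chi(x)=\chi(g)x$ for $x\in\mathcal L_g$; let $V^\chi$ be the space $V$ on which $x\in\mathcal L$ acts as $\alpha_\chi(x)$ does on $V$. Put $$K_\lambda=\{\chi\in\widehat G : V^\chi\cong V\},\qquad H_\lambda=\{g\in G:\chi(g)=1\ \text{for all}\ \chi\in K_\lambda\},\qquad \overline G=G/H_\lambda,$$ and regard $\mathcal L$ and $U(\mathcal L)$ as $\overline G$-graded through the quotient map $G\to\overline G$. Equip $\mathrm{End}(V)$ with the $\overline G$-grading for which $\rho$ is a homomorphism of graded algebras. A graded division algebra is a nonzero graded algebra in which every nonzero homogeneous element is invertible. A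 finite-dimensional $\overline G$-graded division algebra $\mathcal D$ represents the class $\mathrm{Br}(\lambda)=[\mathrm{End}(V)]$ in the $\overline G$-graded Brauer group if $\mathrm{End}(V)\cong\mathrm{End}_{\mathcal D}(W)$ as $\overline G$-graded algebras for some finite-dimensional graded right $\mathcal D$-module $W$. The graded Schur index of $\lambda$ (or of $V$) is the degree of such a $\mathcal D$, i.e. the number $\ell$ with $\mathcal D\cong M_\ell(\mathbb F)$ as ungraded algebras. **Proposition.** The graded Schur index of $V$ is well defined: exactly one $\ell$ arises in this way. For every integer $k\ge 0$, the $\mathcal L$-module $V^k$ admits a $\overline G$-grading that makes it a graded-simple $\mathcal L$-module (a nonzero graded module whose only graded submodules are $0$ and itself) if and only if $k$ equals the graded Schur index of $V$. Such a grading is unique up to isomorphism and shift: if $(W_{\bar g})_{\bar g\in\overline G}$ and $(W'_{\bar g})_{\bar g\in\overline G}$ are two such gradings on $W=V^k$, then there are $\bar s\in\overline G$ and an $\mathcal L$-module automorphism $\varphi$ of $W$ with $\varphi(W_{\bar g})=W'_{\bar g\bar s}$ for all $\bar g\in\overline G$. -/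

import Mathlib

open scoped DirectSum

noncomputable section

namespace GradedLie

/-! ### Gradings -/

section Gradings

variable {F Γ M : Type*} [Field F] [AddCommGroup M] [Module F M]

open Classical in
/-- `𝓜` is a vector space grading: `M` is the internal direct sum of the `𝓜 g`. -/
def IsGrading (𝓜 : Γ → Submodule F M) : Prop :=
  DirectSum.IsInternal 𝓜

/-- The coarsening of a family `𝓜` of subspaces along a map `f` of the index sets. -/
def coarsen {G : Type*} (f : G → Γ) (𝓜 : G → Submodule F M) (γ : Γ) : Submodule F M :=
  ⨆ g : {g : G // f g = γ}, 𝓜 g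

/-- A subspace is graded if it is the sum of its intersections with the components. -/
def IsGradedSubspace (𝓜 : Γ → Submodule F M) (N : Submodule F M) : Prop :=
  N = ⨆ γ, N ⊓ 𝓜 γ

/-- `𝓐` makes the associative unital algebra `A` a `Γ`-graded algebra. -/
structure IsAlgebraGrading {A : Type*} [Ring A] [Algebra F A] [AddCommGroup Γ]
    (𝓐 : Γ → Submodule F A) : Prop where
  isGrading : IsGrading 𝓐
  gradedMonoid : SetLike.GradedMonoid 𝓐

end Gradings

/-! ### Graded modules over a graded Lie algebra -/

section LieModules

variable {F Γ L W : Type*} [Field F] [AddCommGroup Γ] [LieRing L] [LieAlgebra F L]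
  [AddCommGroup W] [Module F W] [LieRingModule L W] [LieModule F L W]

/-- `𝓦` makes `W` a `Γ`-graded module over the Lie algebra `L` with `Γ`-grading `𝓛`. -/
structure IsGradedLieModule (𝓛 : Γ → Submodule F L) (𝓦 : Γ → Submodule F W) : Prop where
  isGrading : IsGrading 𝓦
  lie_mem : ∀ ⦃g h : Γ⦄ ⦃x : L⦄ ⦃w : W⦄, x ∈ 𝓛 g → w ∈ 𝓦 h → ⁅x, w⁆ ∈ 𝓦 (g + h)

/-- `𝓦` makes `W` a graded-simple `L`-module: `W` is a nonzero graded module whose only graded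
submodules are `0` and `W`. -/
structure IsGradedSimple (𝓛 : Γ → Submodule F L) (𝓦 : Γ → Submodule F W) : Prop
    extends IsGradedLieModule 𝓛 𝓦 where
  nontrivial : Nontrivial W
  eq_bot_or_eq_top : ∀ N : LieSubmodule F L W,
    IsGradedSubspace 𝓦 N.toSubmodule → N = ⊥ ∨ N = ⊤

end LieModules

/-! ### The character group action and the subgroup `H_λ` -/

section Inertia

variable {F G L : Type*} [Field F] [AddCommGroup G] [DecidableEq G]
  [LieRing L] [LieAlgebra F L] (𝓛 : G → Submodule F L) [GradedLieAlgebra 𝓛]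

/-- The action `α_χ` of a character `χ` of `G` on `L`: multiplication by `χ g` on `𝓛 g`. -/
def charAction (χ : AddChar G F) : L →ₗ[F] L :=
  DirectSum.toModule F G L (fun g => χ g • (𝓛 g).subtype) ∘ₗ
    (DirectSum.decomposeLinearEquiv 𝓛).toLinearMap

variable (V : Type*) [AddCommGroup V] [Module F V] [LieRingModule L V] [LieModule F L V]

/-- The inertia group `K_λ` of `V = V_λ`: the characters `χ` for which `V` is isomorphic to the
twisted module `V^χ`, in which `x ∈ L` acts as `α_χ x` does on `V`. -/
def inertia : Set (AddChar G F) :=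
  {χ | ∃ u : V ≃ₗ[F] V, ∀ (x : L) (v : V), u ⁅x, v⁆ = ⁅charAction 𝓛 χ x, u v⁆}

/-- The subgroup `H_λ = K_λ^⊥` of `G`. -/
def inertiaPerp : AddSubgroup G where
  carrier := {g | ∀ χ ∈ inertia 𝓛 V, χ g = 1}
  zero_mem' := fun χ _ => χ.map_zero_eq_one
  add_mem' := fun ha hb χ hχ => by rw [χ.map_add_eq_mul, ha χ hχ, hb χ hχ, one_mul]
  neg_mem' := fun ha χ hχ => by rw [χ.map_neg_eq_inv, ha χ hχ, inv_one]

/-- The grading on `L` by `G/H_λ` induced by its `G`-grading. -/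
def quotientGrading : G ⧸ inertiaPerp 𝓛 V → Submodule F L :=
  coarsen (QuotientAddGroup.mk' (inertiaPerp 𝓛 V)) 𝓛

end Inertia

/-! ### The graded Brauer class of a graded matrix algebra -/

section Brauer

variable {F Γ : Type*} [Field F] [AddCommGroup Γ]

/-- `𝓓` makes `D` a finite-dimensional graded division algebra. -/
structure IsGradedDivisionAlgebra {D : Type*} [Ring D] [Algebra F D]
    (𝓓 : Γ → Submodule F D) : Prop extends IsAlgebraGrading 𝓓 where
  finite : Module.Finite F D
  nontrivial : Nontrivial D
  isUnit : ∀ ⦃g : Γ⦄ ⦃d : D⦄, d ∈ 𝓓 g → d ≠ 0 → IsUnit d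

/-- `𝓦` makes the right `D`-module `W` a finite-dimensional graded right `D`-module. -/
structure IsGradedRightModule {D W : Type*} [Ring D] [Algebra F D] [AddCommGroup W] [Module F W]
    [Module Dᵐᵒᵖ W] (𝓓 : Γ → Submodule F D) (𝓦 : Γ → Submodule F W) : Prop where
  isGrading : IsGrading 𝓦
  finite : Module.Finite F W
  smul_mem : ∀ ⦃g h : Γ⦄ ⦃w : W⦄ ⦃d : D⦄,
    w ∈ 𝓦 g → d ∈ 𝓓 h → MulOpposite.op d • w ∈ 𝓦 (g + h)

/-- `f ∈ End_D(W)` is homogeneous of degree `g`. -/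
def IsHomogeneousEnd {D W : Type*} [Ring D] [AddCommGroup W] [Module F W] [Module Dᵐᵒᵖ W]
    (𝓦 : Γ → Submodule F W) (g : Γ) (f : Module.End Dᵐᵒᵖ W) : Prop :=
  ∀ ⦃h : Γ⦄ ⦃w : W⦄, w ∈ 𝓦 h → f w ∈ 𝓦 (g + h)

/-- The graded division algebra `D` represents the class `[R]` of the graded algebra `R` in the
`Γ`-graded Brauer group: `R` is isomorphic, as a graded algebra, to `End_D(W)` for a
finite-dimensional graded right `D`-module `W`. -/
def RepresentsClass.{u, v, w, r, d} {F : Type u} {Γ : Type v} [Field F] [AddCommGroup Γ]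
    {R : Type r} [Ring R] [Algebra F R] (𝓡 : Γ → Submodule F R)
    {D : Type d} [Ring D] [Algebra F D] (𝓓 : Γ → Submodule F D) : Prop :=
  IsGradedDivisionAlgebra 𝓓 ∧
  ∃ (W : Type w) (_ : AddCommGroup W) (_ : Module F W) (_ : Module Dᵐᵒᵖ W)
    (_ : IsScalarTower F Dᵐᵒᵖ W) (𝓦 : Γ → Submodule F W) (e : R ≃ₐ[F] Module.End Dᵐᵒᵖ W),
    IsGradedRightModule 𝓓 𝓦 ∧
    ∀ (g : Γ) (a : R), a ∈ 𝓡 g ↔ IsHomogeneousEnd 𝓦 g (e a)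

/-- `D` is a matrix algebra of degree `n`. -/
def HasDegree (F : Type*) [Field F] (D : Type*) [Ring D] [Algebra F D] (n : ℕ) : Prop :=
  Nonempty (D ≃ₐ[F] Matrix (Fin n) (Fin n) F)

end Brauer

/-! ### The graded Schur index -/

section SchurIndex

/-- The grading on `U(L)` induced by a grading `𝓛` on `L`: the component of degree `g` is spanned
by the products `x₁ ⋯ xₙ` of elements `xᵢ ∈ 𝓛 gᵢ` with `g₁ + ⋯ + gₙ = g`. -/
def envelopingGrading {F Γ L : Type*} [Field F] [AddCommGroup Γ] [LieRing L] [LieAlgebra F L]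
    (𝓛 : Γ → Submodule F L) (g : Γ) : Submodule F (UniversalEnvelopingAlgebra F L) :=
  Submodule.span F {a | ∃ l : List (Γ × L), (∀ p ∈ l, p.2 ∈ 𝓛 p.1) ∧
    (l.map Prod.fst).sum = g ∧
    (l.map fun p => UniversalEnvelopingAlgebra.ι F p.2).prod = a}

/-- `𝓡` is an algebra grading on `End(V)` for which the representation `ρ : U(L) → End(V)` is a
homomorphism of graded algebras. -/
structure IsInducedEndGrading {F Γ L V : Type*} [Field F] [AddCommGroup Γ] [LieRing L]
    [LieAlgebra F L] [AddCommGroup V] [Module F V] [LieRingModule L V] [LieModule F L V]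
    (𝓛 : Γ → Submodule F L) (𝓡 : Γ → Submodule F (Module.End F V)) : Prop
    extends IsAlgebraGrading 𝓡 where
  map_mem : ∀ (g : Γ), ∀ a ∈ envelopingGrading 𝓛 g,
    UniversalEnvelopingAlgebra.lift F (LieModule.toEnd F L V) a ∈ 𝓡 g

/-- `ℓ` is the graded Schur index of the simple module `V = V_λ`: the degree of a graded division
algebra that represents the Brauer invariant `Br(λ)`, i.e. the class of `End(V)` with its induced
`G/H_λ`-grading in the `G/H_λ`-graded Brauer group. All algebras and modules in question are
finite-dimensional over `F`, so that they may be taken in the universe of `V`. -/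
def IsGradedSchurIndex.{u, v, w, t} {F : Type u} {G : Type v} {L : Type w} [Field F]
    [AddCommGroup G] [DecidableEq G] [LieRing L] [LieAlgebra F L]
    (𝓛 : G → Submodule F L) [GradedLieAlgebra 𝓛]
    (V : Type t) [AddCommGroup V] [Module F V] [LieRingModule L V] [LieModule F L V]
    (ℓ : ℕ) : Prop :=
  ∃ 𝓡 : G ⧸ inertiaPerp 𝓛 V → Submodule F (Module.End F V),
    IsInducedEndGrading (quotientGrading 𝓛 V) 𝓡 ∧
    ∃ (D : Type t) (_ : Ring D) (_ : Algebra F D) (𝓓 : G ⧸ inertiaPerp 𝓛 V → Submodule F D),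
      RepresentsClass.{u, v, t, t, t} 𝓡 𝓓 ∧ HasDegree F D ℓ

end SchurIndex

end GradedLie

end

noncomputable section

namespace GradedLie

section GradingLemmas

variable {F Γ M N : Type*} [Field F] [AddCommGroup M] [Module F M] [AddCommGroup N] [Module F N]
  {𝓜 : Γ → Submodule F M} {𝓝 : Γ → Submodule F N}

theorem isGrading_iff : IsGrading 𝓜 ↔ iSupIndep 𝓜 ∧ iSup 𝓜 = ⊤ := by
  classical
  unfold IsGrading
  convert DirectSum.isInternal_submodule_iff_iSupIndep_and_iSup_eq_top 𝓜

theorem IsGrading.iSup_eq_top (h : IsGrading 𝓜) : iSup 𝓜 = ⊤ := (isGrading_iff.1 h).2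

open Classical in
theorem IsGrading.bijective (h : IsGrading 𝓜) :
    Function.Bijective (DirectSum.coeLinearMap 𝓜) := h

open Classical in
/-- The projection of a graded space onto its component of degree `g`. -/
def IsGrading.proj (h : IsGrading 𝓜) (g : Γ) : M →ₗ[F] M :=
  (𝓜 g).subtype ∘ₗ DirectSum.component F Γ (fun i => 𝓜 i) g ∘ₗ
    (LinearEquiv.ofBijective (DirectSum.coeLinearMap 𝓜) h.bijective).symm.toLinearMap

theorem IsGrading.proj_mem (h : IsGrading 𝓜) (g : Γ) (x : M) : h.proj g x ∈ 𝓜 g := by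
  simp [IsGrading.proj]

open Classical in
theorem IsGrading.ofBijective_symm_of_mem (h : IsGrading 𝓜) {g : Γ} {x : M} (hx : x ∈ 𝓜 g) :
    (LinearEquiv.ofBijective (DirectSum.coeLinearMap 𝓜) h.bijective).symm x =
      DirectSum.lof F Γ (fun i => 𝓜 i) g ⟨x, hx⟩ := by
  rw [LinearEquiv.symm_apply_eq]
  simp

theorem IsGrading.proj_of_mem (h : IsGrading 𝓜) {g : Γ} {x : M} (hx : x ∈ 𝓜 g) :
    h.proj g x = x := by
  classical
  simp only [IsGrading.proj, LinearMap.comp_apply, LinearEquiv.coe_coe,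
    h.ofBijective_symm_of_mem hx]
  simp [DirectSum.component.lof_self]

theorem IsGrading.proj_of_mem_ne (h : IsGrading 𝓜) {g g' : Γ} {x : M} (hx : x ∈ 𝓜 g)
    (hg : g ≠ g') : h.proj g' x = 0 := by
  classical
  simp only [IsGrading.proj, LinearMap.comp_apply, LinearEquiv.coe_coe,
    h.ofBijective_symm_of_mem hx, DirectSum.component.of]
  simp [hg]

theorem IsGrading.mem_iff_proj_eq (h : IsGrading 𝓜) {g : Γ} {x : M} :
    x ∈ 𝓜 g ↔ h.proj g x = x :=
  ⟨h.proj_of_mem, fun hx => hx ▸ h.proj_mem g x⟩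

theorem IsGrading.induction_on (h : IsGrading 𝓜) {p : M → Prop} (x : M)
    (mem : ∀ g, ∀ y ∈ 𝓜 g, p y) (zero : p 0) (add : ∀ y z, p y → p z → p (y + z)) : p x :=
  Submodule.iSup_induction 𝓜 (motive := p) (h.iSup_eq_top ▸ Submodule.mem_top : x ∈ iSup 𝓜)
    mem zero add

theorem IsGrading.exists_eq_sum_proj (h : IsGrading 𝓜) (x : M) :
    ∃ s : Finset Γ, x = ∑ g ∈ s, h.proj g x := by
  classical
  suffices H : ∃ s : Finset Γ, ∀ t, s ⊆ t → x = ∑ g ∈ t, h.proj g x by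
    obtain ⟨s, hs⟩ := H
    exact ⟨s, hs s subset_rfl⟩
  refine h.induction_on (p := fun x => ∃ s : Finset Γ, ∀ t, s ⊆ t → x = ∑ g ∈ t, h.proj g x) x
    (fun g y hy => ⟨{g}, fun t ht => ?_⟩) ⟨∅, by simp⟩ ?_
  · rw [Finset.sum_eq_single_of_mem g (by simpa using ht)
      (fun b _ hb => h.proj_of_mem_ne hy hb.symm), h.proj_of_mem hy]
  · rintro y z ⟨s, hs⟩ ⟨s', hs'⟩
    refine ⟨s ∪ s', fun t ht => ?_⟩
    simp only [map_add, Finset.sum_add_distrib]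
    rw [← hs t (Finset.union_subset_left ht), ← hs' t (Finset.union_subset_right ht)]

theorem IsGrading.mem_of_proj_mem (h : IsGrading 𝓜) {P : Submodule F M} {x : M}
    (hx : ∀ g, h.proj g x ∈ P) : x ∈ P := by
  obtain ⟨s, hs⟩ := h.exists_eq_sum_proj x
  rw [hs]
  exact P.sum_mem fun g _ => hx g

theorem IsGrading.eq_zero_of_proj_eq_zero (h : IsGrading 𝓜) {x : M}
    (hx : ∀ g, h.proj g x = 0) : x = 0 := by
  have := h.mem_of_proj_mem (P := ⊥) (x := x) (by simpa using hx)
  simpa using this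

theorem IsGrading.exists_proj_ne_zero (h : IsGrading 𝓜) {x : M} (hx : x ≠ 0) :
    ∃ g, h.proj g x ≠ 0 := by
  by_contra! H
  exact hx (h.eq_zero_of_proj_eq_zero H)

theorem IsGrading.isGradedSubspace_iff (h : IsGrading 𝓜) {P : Submodule F M} :
    IsGradedSubspace 𝓜 P ↔ ∀ g, ∀ x ∈ P, h.proj g x ∈ P := by
  constructor
  · intro hP g x hx
    rw [hP] at hx
    refine Submodule.iSup_induction _ (motive := fun x => h.proj g x ∈ P) hx ?_ (by simp) ?_
    · rintro g' y ⟨hyP, hy⟩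
      by_cases hg : g' = g
      · subst hg
        rwa [h.proj_of_mem hy]
      · rw [h.proj_of_mem_ne hy hg]
        exact P.zero_mem
    · intro y z hy hz
      rw [map_add]
      exact P.add_mem hy hz
  · intro hP
    refine le_antisymm (fun x hx => h.mem_of_proj_mem fun g => ?_)
      (iSup_le fun g => inf_le_left)
    exact Submodule.mem_iSup_of_mem g ⟨hP g x hx, h.proj_mem g x⟩

theorem IsGrading.map_proj (h : IsGrading 𝓜) (h' : IsGrading 𝓝) (σ : Γ ≃ Γ) (f : M →ₗ[F] N)
    (hf : ∀ g, ∀ x ∈ 𝓜 g, f x ∈ 𝓝 (σ g)) (g : Γ) (x : M) :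
    h'.proj (σ g) (f x) = f (h.proj g x) := by
  refine h.induction_on (p := fun x => h'.proj (σ g) (f x) = f (h.proj g x)) x
    (fun k y hy => ?_) (by simp) (fun y z hy hz => by simp [hy, hz])
  by_cases hk : k = g
  · subst hk
    rw [h.proj_of_mem hy, h'.proj_of_mem (hf _ _ hy)]
  · rw [h.proj_of_mem_ne hy hk, h'.proj_of_mem_ne (hf _ _ hy) (by simpa using hk), map_zero]

theorem IsGrading.isGradedSubspace_ker (h : IsGrading 𝓜) (h' : IsGrading 𝓝) (σ : Γ ≃ Γ)
    (f : M →ₗ[F] N) (hf : ∀ g, ∀ x ∈ 𝓜 g, f x ∈ 𝓝 (σ g)) :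
    IsGradedSubspace 𝓜 (LinearMap.ker f) := by
  rw [h.isGradedSubspace_iff]
  intro g x hx
  rw [LinearMap.mem_ker] at hx ⊢
  rw [← h.map_proj h' σ f hf, hx, map_zero]

theorem IsGrading.isGradedSubspace_range (h : IsGrading 𝓜) (h' : IsGrading 𝓝) (σ : Γ ≃ Γ)
    (f : M →ₗ[F] N) (hf : ∀ g, ∀ x ∈ 𝓜 g, f x ∈ 𝓝 (σ g)) :
    IsGradedSubspace 𝓝 (LinearMap.range f) := by
  rw [h'.isGradedSubspace_iff]
  rintro g _ ⟨x, rfl⟩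
  refine ⟨h.proj (σ.symm g) x, ?_⟩
  rw [← h.map_proj h' σ f hf, σ.apply_symm_apply]

/-- A bijective homogeneous map identifies the components. -/
theorem IsGrading.mem_iff_of_injective (h : IsGrading 𝓜) (h' : IsGrading 𝓝) (σ : Γ ≃ Γ)
    (f : M →ₗ[F] N) (hf : ∀ g, ∀ x ∈ 𝓜 g, f x ∈ 𝓝 (σ g)) (hinj : Function.Injective f)
    (g : Γ) (x : M) : f x ∈ 𝓝 (σ g) ↔ x ∈ 𝓜 g := by
  rw [h'.mem_iff_proj_eq, h.mem_iff_proj_eq, h.map_proj h' σ f hf, hinj.eq_iff]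

theorem isGrading_of_sum_eq_zero
    (h0 : ∀ (s : Finset Γ) (x : Γ → M), (∀ g, x g ∈ 𝓜 g) → ∑ g ∈ s, x g = 0 →
      ∀ g ∈ s, x g = 0)
    (htop : iSup 𝓜 = ⊤) : IsGrading 𝓜 := by
  refine isGrading_iff.2 ⟨?_, htop⟩
  classical
  refine iSupIndep_of_dfinsupp_lsum_injective _ ?_
  rw [← LinearMap.ker_eq_bot, LinearMap.ker_eq_bot']
  intro m hm
  ext g
  rw [DFinsupp.lsum_apply_apply, DFinsupp.sumAddHom_apply, DFinsupp.sum] at hm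
  by_cases hg : g ∈ m.support
  · simpa using h0 m.support (fun g => (m g : M)) (fun g => (m g).2) hm g hg
  · simpa using hg

theorem IsGrading.eq_zero_of_sum_eq_zero (h : IsGrading 𝓜) {s : Finset Γ} {x : Γ → M}
    (hx : ∀ g, x g ∈ 𝓜 g) (hs : ∑ g ∈ s, x g = 0) {g : Γ} (hg : g ∈ s) : x g = 0 := by
  have := congrArg (h.proj g) hs
  rwa [map_sum, map_zero, Finset.sum_eq_single_of_mem g hg
    (fun b _ hb => h.proj_of_mem_ne (hx b) hb), h.proj_of_mem (hx g)] at this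

/-- Joint eigenspaces for separated systems of eigenvalues form a grading if they span. -/
theorem isGrading_of_eigen
    (hsep : ∀ a b : Γ, a ≠ b → ∃ (f : M →ₗ[F] M) (μ : Γ → F), μ a ≠ μ b ∧
      ∀ g, ∀ x ∈ 𝓜 g, f x = μ g • x)
    (htop : iSup 𝓜 = ⊤) : IsGrading 𝓜 := by
  classical
  refine isGrading_of_sum_eq_zero (fun s => ?_) htop
  induction s using Finset.induction_on with
  | empty => simp
  | insert a s ha ih =>
    intro x hx hsum
    have hs : ∀ b ∈ s, x b = 0 := by
      intro b hb
      obtain ⟨f, μ, hμ, hf⟩ := hsep a b (by rintro rfl; exact ha hb)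
      have h1 : ∑ g ∈ s, (μ g - μ a) • x g = 0 := by
        have h2 := congrArg f hsum
        have h3 := congrArg (μ a • ·) hsum
        simp only [map_sum, map_zero, smul_zero, Finset.smul_sum] at h2 h3
        have h4 := (h2.trans h3.symm)
        rw [Finset.sum_congr rfl (fun g _ => hf g (x g) (hx g)), Finset.sum_insert ha,
          Finset.sum_insert ha, add_right_inj] at h4
        simp only [sub_smul, Finset.sum_sub_distrib, h4, sub_self]
      have h5 := ih (fun g => (μ g - μ a) • x g) (fun g => (𝓜 g).smul_mem _ (hx g)) h1 b hb
      exact (smul_eq_zero.1 h5).resolve_left (sub_ne_zero.2 hμ.symm)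
    intro g hg
    rcases Finset.mem_insert.1 hg with rfl | hg
    · rwa [Finset.sum_insert ha, Finset.sum_eq_zero hs, add_zero] at hsum
    · exact hs g hg

theorem IsGrading.comap_subtype (h : IsGrading 𝓜) {P : Submodule F M}
    (hP : IsGradedSubspace 𝓜 P) : IsGrading fun g => (𝓜 g).comap P.subtype := by
  refine isGrading_of_sum_eq_zero (fun s x hx hs g hg => ?_) ?_
  · have : ∑ g ∈ s, (x g : M) = 0 := by
      simpa using congrArg P.subtype hs
    exact Subtype.ext (h.eq_zero_of_sum_eq_zero (x := fun g => (x g : M)) hx this hg)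
  · rw [eq_top_iff]
    rintro x -
    obtain ⟨s, hs⟩ := h.exists_eq_sum_proj (x : M)
    have hx : x = ∑ g ∈ s, (⟨h.proj g x, h.isGradedSubspace_iff.1 hP g x x.2⟩ : P) := by
      ext
      simpa using hs
    rw [hx]
    exact Submodule.sum_mem _ fun g _ => Submodule.mem_iSup_of_mem g (h.proj_mem g _)

theorem IsGrading.map_equiv (h : IsGrading 𝓜) (e : M ≃ₗ[F] N) :
    IsGrading fun g => (𝓜 g).map (e : M →ₗ[F] N) := by
  refine isGrading_of_sum_eq_zero (fun s x hx hs g hg => ?_) ?_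
  · have h1 : ∑ g ∈ s, e.symm (x g) = 0 := by
      simpa using congrArg e.symm hs
    have := h.eq_zero_of_sum_eq_zero (x := fun g => e.symm (x g))
      (fun g => by obtain ⟨y, hy, hyx⟩ := hx g; simpa [← hyx] using hy) h1 hg
    simpa using this
  · rw [← Submodule.map_iSup, h.iSup_eq_top, Submodule.map_top, LinearEquiv.range]

end GradingLemmas

section SimpleAlgebra

variable {A : Type*} [Ring A]

section Endomorphisms

variable (F : Type*) [Field F] [IsAlgClosed F] [Algebra F A]

/-- The endomorphism algebra of the `n`-th power of a simple module is a matrix algebra. -/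
theorem nonempty_end_algEquiv_matrix (S : Type*) [AddCommGroup S]
    [Module F S] [FiniteDimensional F S] [Module A S] [IsScalarTower F A S] [IsSimpleModule A S]
    (n : ℕ) : Nonempty (Module.End A (Fin n → S) ≃ₐ[F] Matrix (Fin n) (Fin n) F) :=
  ⟨(endVecAlgEquivMatrixEnd (Fin n) F A S).trans
    (AlgEquiv.ofBijective (Algebra.ofId F (Module.End A S))
      (IsSimpleModule.algebraMap_end_bijective_of_isAlgClosed F)).symm.mapMatrix⟩

theorem finrank_end_of_linearEquiv {M S : Type*} [AddCommGroup S]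
    [Module F S] [FiniteDimensional F S] [Module A S] [IsScalarTower F A S] [IsSimpleModule A S]
    [AddCommGroup M] [Module F M] [Module A M] [IsScalarTower F A M]
    {n : ℕ} (e : M ≃ₗ[A] (Fin n → S)) :
    Module.finrank F (Module.End A M) = n * n ∧ Module.finrank F M = n * Module.finrank F S := by
  obtain ⟨e'⟩ := nonempty_end_algEquiv_matrix (A := A) F S n
  constructor
  · rw [((e.conjAlgEquiv F).trans e').toLinearEquiv.finrank_eq]
    simp [Module.finrank_matrix]
  · rw [(e.restrictScalars F).finrank_eq, Module.finrank_pi_fintype]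
    simp

end Endomorphisms

variable [IsSimpleRing A] [IsArtinianRing A]

theorem isIsotypicOfType_of_isSimpleRing (M S : Type*) [AddCommGroup M] [Module A M]
    [AddCommGroup S] [Module A S] [IsSimpleModule A S] : IsIsotypicOfType A M S := by
  intro m _
  have h := IsSimpleRing.isIsotypic A (m × S)
  have e₁ := LinearEquiv.ofInjective (LinearMap.inl A m S) LinearMap.inl_injective
  have e₂ := LinearEquiv.ofInjective (LinearMap.inr A m S) LinearMap.inr_injective
  have := IsSimpleModule.congr e₁.symm
  have := IsSimpleModule.congr e₂.symm
  obtain ⟨e⟩ := h (LinearMap.range (LinearMap.inr A m S)) (LinearMap.range (LinearMap.inl A m S))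
  exact ⟨e₁.trans (e.trans e₂.symm)⟩

theorem exists_linearEquiv_fun_of_isSimpleRing (M S : Type*) [AddCommGroup M] [Module A M]
    [Module.Finite A M] [AddCommGroup S] [Module A S] [IsSimpleModule A S] :
    ∃ n : ℕ, Nonempty (M ≃ₗ[A] (Fin n → S)) :=
  (isIsotypicOfType_of_isSimpleRing M S).linearEquiv_fun

variable (F : Type*) [Field F] [IsAlgClosed F] [Algebra F A]

/-- Over an algebra `A ≅ M_ℓ(F)`, the dimension of a module is `ℓ` times the square root of the
dimension of its endomorphism algebra. -/
theorem finrank_eq_mul_of_finrank_end [FiniteDimensional F A] {M : Type*} [AddCommGroup M]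
    [Module F M] [Module A M] [IsScalarTower F A M] [Module.Finite F M] {l n : ℕ}
    (hl : Module.finrank F A = l * l)
    (hn : Module.finrank F (Module.End A M) = n * n) : Module.finrank F M = n * l := by
  obtain ⟨S, hS⟩ := IsAtomic.exists_atom (Submodule A A)
  rw [← isSimpleModule_iff_isAtom] at hS
  have : Module.Finite A M := Module.Finite.of_restrictScalars_finite F A M
  have : FiniteDimensional F S :=
    FiniteDimensional.of_injective (S.subtype.restrictScalars F) S.subtype_injective
  obtain ⟨p, ⟨e⟩⟩ := exists_linearEquiv_fun_of_isSimpleRing (A := A) M S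
  obtain ⟨q, ⟨e'⟩⟩ := exists_linearEquiv_fun_of_isSimpleRing (A := A) A S
  obtain ⟨h₁, h₂⟩ := finrank_end_of_linearEquiv F e
  obtain ⟨h₃, h₄⟩ := finrank_end_of_linearEquiv F e'
  have h₅ : Module.finrank F (Module.End A A) = Module.finrank F A := by
    rw [← (AlgEquiv.moduleEndSelf (A := A) F).toLinearEquiv.finrank_eq]
    exact (MulOpposite.opLinearEquiv F).finrank_eq.symm
  have hq : q = l := Nat.mul_self_inj.1 (by rw [← h₃, h₅, hl])
  have hp : p = n := Nat.mul_self_inj.1 (by rw [← h₁, hn])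
  subst hq hp
  have hq0 : q ≠ 0 := by
    rintro rfl
    exact (Module.finrank_pos (R := F) (M := A)).ne' (by simpa using hl)
  rw [h₂, Nat.eq_of_mul_eq_mul_left (Nat.pos_of_ne_zero hq0) (h₄.symm.trans hl)]

end SimpleAlgebra

section GradedModules

variable {F Γ R M N : Type*} [Field F] [AddCommGroup Γ] [Ring R] [Algebra F R]
  [AddCommGroup M] [Module F M] [Module R M] [IsScalarTower F R M]
  [AddCommGroup N] [Module F N] [Module R N] [IsScalarTower F R N]
  {𝓡 : Γ → Submodule F R} {𝓜 : Γ → Submodule F M} {𝓝 : Γ → Submodule F N}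

/-- `𝓜` makes `M` a graded left module over the graded algebra `R`. -/
structure IsGradedModule (𝓡 : Γ → Submodule F R) (𝓜 : Γ → Submodule F M) : Prop where
  isGrading : IsGrading 𝓜
  smul_mem : ∀ ⦃g h : Γ⦄ ⦃r : R⦄ ⦃m : M⦄, r ∈ 𝓡 g → m ∈ 𝓜 h → r • m ∈ 𝓜 (g + h)

/-- `𝓜` makes `M` a graded-simple left module over the graded algebra `R`. -/
structure IsGradedSimpleModule (𝓡 : Γ → Submodule F R) (𝓜 : Γ → Submodule F M) : Prop
    extends IsGradedModule 𝓡 𝓜 where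
  nontrivial : Nontrivial M
  eq_bot_or_eq_top : ∀ P : Submodule R M,
    IsGradedSubspace 𝓜 (P.restrictScalars F) → P = ⊥ ∨ P = ⊤

theorem IsGradedSimpleModule.map_equiv (h : IsGradedSimpleModule 𝓡 𝓜) (e : M ≃ₗ[R] N) :
    IsGradedSimpleModule 𝓡 fun g => (𝓜 g).map (e.restrictScalars F : M →ₗ[F] N) := by
  have hN := h.isGrading.map_equiv (e.restrictScalars F)
  refine ⟨⟨hN, ?_⟩, ?_, ?_⟩
  · rintro g g' r _ hr ⟨m, hm, rfl⟩
    exact ⟨r • m, h.smul_mem hr hm, by simp⟩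
  · have := h.nontrivial
    exact e.symm.toEquiv.nontrivial
  · intro P hP
    have hP' : IsGradedSubspace 𝓜 ((P.comap (e : M →ₗ[R] N)).restrictScalars F) := by
      rw [hN.isGradedSubspace_iff] at hP
      rw [h.isGrading.isGradedSubspace_iff]
      intro g x hx
      have h₁ := h.isGrading.map_proj hN (Equiv.refl Γ) (e.restrictScalars F : M →ₗ[F] N)
        (fun g x hx => ⟨x, hx, rfl⟩) g x
      have h₂ := hP g (e x) hx
      change e (h.isGrading.proj g x) ∈ P
      have h₃ : hN.proj g (e x) = e (h.isGrading.proj g x) := h₁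
      rw [← h₃]
      exact h₂
    have hPe : P = (P.comap (e : M →ₗ[R] N)).map (e : M →ₗ[R] N) :=
      (Submodule.map_comap_eq_of_surjective e.surjective P).symm
    rcases h.eq_bot_or_eq_top _ hP' with H | H
    · left
      rw [hPe, H, Submodule.map_bot]
    · right
      rw [hPe, H, Submodule.map_top, LinearMap.range_eq_top.2 e.surjective]

/-- A nonzero finite-dimensional graded module has a graded-simple graded submodule. -/
theorem IsGradedModule.exists_isGradedSimpleModule [Nontrivial M] [IsArtinian R M]
    (h : IsGradedModule 𝓡 𝓜) : ∃ P : Submodule R M, P ≠ ⊥ ∧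
      IsGradedSimpleModule 𝓡 fun g => (𝓜 g).comap (P.subtype.restrictScalars F) := by
  obtain ⟨P, ⟨hP0, hP⟩, hmin⟩ := (wellFounded_lt (α := Submodule R M)).has_min
    {P | P ≠ ⊥ ∧ IsGradedSubspace 𝓜 (P.restrictScalars F)}
    ⟨⊤, top_ne_bot, by simp [h.isGrading.isGradedSubspace_iff]⟩
  have hgr : IsGrading fun g => (𝓜 g).comap (P.subtype.restrictScalars F) :=
    h.isGrading.comap_subtype hP
  refine ⟨P, hP0, ⟨hgr, fun g g' r m hr hm => h.smul_mem hr hm⟩,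
    Submodule.nontrivial_iff_ne_bot.2 hP0, fun Q hQ => ?_⟩
  by_cases hQ0 : Q = ⊥
  · exact Or.inl hQ0
  right
  have hle : Q.map P.subtype ≤ P := Submodule.map_subtype_le P Q
  have hgrQ : IsGradedSubspace 𝓜 ((Q.map P.subtype).restrictScalars F) := by
    rw [h.isGrading.isGradedSubspace_iff]
    rintro g _ ⟨x, hx, rfl⟩
    refine ⟨hgr.proj g x, hgr.isGradedSubspace_iff.1 hQ g x hx, ?_⟩
    exact (hgr.map_proj h.isGrading (Equiv.refl Γ) (P.subtype.restrictScalars F)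
      (fun g x hx => hx) g x).symm
  have heq : Q.map P.subtype = P := by
    refine hle.eq_of_not_lt fun hlt => hmin _ ⟨?_, hgrQ⟩ hlt
    exact fun h0 => hQ0 (Submodule.map_injective_of_injective P.subtype_injective
      (h0.trans (Submodule.map_bot _).symm))
  refine eq_top_iff.2 fun x _ => ?_
  have hx : (x : M) ∈ Q.map P.subtype := heq.symm ▸ x.2
  obtain ⟨y, hy, hyx⟩ := hx
  rwa [← Subtype.ext (by simpa using hyx : (y : M) = x)]

/-- A homogeneous homomorphism of graded-simple modules is bijective unless it is zero. -/
theorem IsGradedSimpleModule.bijective (hM : IsGradedSimpleModule 𝓡 𝓜)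
    (hN : IsGradedSimpleModule 𝓡 𝓝) (σ : Γ ≃ Γ) (f : M →ₗ[R] N)
    (hf : ∀ g, ∀ x ∈ 𝓜 g, f x ∈ 𝓝 (σ g)) (hf0 : f ≠ 0) : Function.Bijective f := by
  constructor
  · rw [← LinearMap.ker_eq_bot]
    refine (hM.eq_bot_or_eq_top _ ?_).resolve_right fun h => hf0 (LinearMap.ker_eq_top.1 h)
    exact hM.isGrading.isGradedSubspace_ker hN.isGrading σ (f.restrictScalars F) hf
  · rw [← LinearMap.range_eq_top]
    refine (hN.eq_bot_or_eq_top _ ?_).resolve_left fun h => hf0 (LinearMap.range_eq_bot.1 h)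
    exact hM.isGrading.isGradedSubspace_range hN.isGrading σ (f.restrictScalars F) hf

/-- A graded-simple faithful module is isomorphic up to shift to any graded-simple graded left
ideal. -/
theorem IsGradedSimpleModule.exists_equiv_ideal [FaithfulSMul R M]
    (hM : IsGradedSimpleModule 𝓡 𝓜) {I : Submodule R R} (hI0 : I ≠ ⊥)
    (hI : IsGradedSimpleModule 𝓡 fun g => (𝓡 g).comap (I.subtype.restrictScalars F)) :
    ∃ (s : Γ) (φ : I ≃ₗ[R] M), ∀ (g : Γ) (x : I), φ x ∈ 𝓜 (g + s) ↔ (x : R) ∈ 𝓡 g := by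
  obtain ⟨a, haI, ha0⟩ := Submodule.exists_mem_ne_zero_of_ne_bot hI0
  obtain ⟨s, m, hm, ham⟩ : ∃ s, ∃ m ∈ 𝓜 s, a • m ≠ 0 := by
    by_contra! H
    refine ha0 (FaithfulSMul.eq_of_smul_eq_smul (α := M) fun m => ?_)
    rw [zero_smul]
    exact hM.isGrading.induction_on (p := fun m => a • m = 0) m H (smul_zero a)
      (fun y z hy hz => by rw [smul_add, hy, hz, add_zero])
  let f : I →ₗ[R] M := (LinearMap.toSpanSingleton R M m) ∘ₗ I.subtype
  have hf : ∀ g, ∀ x ∈ (𝓡 g).comap (I.subtype.restrictScalars F),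
      f x ∈ 𝓜 (Equiv.addRight s g) := fun g x hx => hM.smul_mem hx hm
  have hbij := hI.bijective hM (Equiv.addRight s) f hf fun h =>
    ham (by simpa [f] using LinearMap.congr_fun h ⟨a, haI⟩)
  refine ⟨s, LinearEquiv.ofBijective f hbij, fun g x => ?_⟩
  exact hI.isGrading.mem_iff_of_injective hM.isGrading (Equiv.addRight s)
    (f.restrictScalars F) hf hbij.1 g x

/-- Faithful graded-simple modules over a graded Artinian algebra are isomorphic up to shift. -/
theorem IsGradedSimpleModule.exists_equiv [Nontrivial R] [IsArtinianRing R] [FaithfulSMul R M]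
    [FaithfulSMul R N] (h𝓡 : IsAlgebraGrading 𝓡) (hM : IsGradedSimpleModule 𝓡 𝓜)
    (hN : IsGradedSimpleModule 𝓡 𝓝) :
    ∃ (s : Γ) (φ : M ≃ₗ[R] N), ∀ (g : Γ) (x : M), φ x ∈ 𝓝 (g + s) ↔ x ∈ 𝓜 g := by
  obtain ⟨I, hI0, hI⟩ := IsGradedModule.exists_isGradedSimpleModule (M := R)
    ⟨h𝓡.isGrading, fun g h r m hr hm => h𝓡.gradedMonoid.mul_mem hr hm⟩
  obtain ⟨s, φ, hφ⟩ := hM.exists_equiv_ideal hI0 hI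
  obtain ⟨t, ψ, hψ⟩ := hN.exists_equiv_ideal hI0 hI
  refine ⟨t - s, φ.symm.trans ψ, fun g x => ?_⟩
  have h₁ := hψ (g - s) (φ.symm x)
  have h₂ := hφ (g - s) (φ.symm x)
  rw [LinearEquiv.apply_symm_apply, sub_add_cancel] at h₂
  rw [h₂, ← h₁, LinearEquiv.trans_apply, sub_add_eq_add_sub, add_sub_assoc]

end GradedModules

section Density

variable {F L V : Type*} [Field F] [LieRing L] [LieAlgebra F L]
  [AddCommGroup V] [Module F V] [LieRingModule L V] [LieModule F L V]

/-- **Burnside's theorem**: the operators of an irreducible representation generate `End V`. -/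
theorem adjoin_range_toEnd [IsAlgClosed F] [FiniteDimensional F V] [LieModule.IsIrreducible F L V] :
    Algebra.adjoin F (Set.range (LieModule.toEnd F L V)) = ⊤ := by
  set A := Algebra.adjoin F (Set.range (LieModule.toEnd F L V)) with hA
  have hmem : ∀ x : L, LieModule.toEnd F L V x ∈ A := fun x =>
    Algebra.subset_adjoin (Set.mem_range_self x)
  have hnt : Nontrivial V := LieSubmodule.nontrivial_iff F L V |>.1 inferInstance
  have : IsSimpleModule A V :=
    { exists_pair_ne := ⟨⊥, ⊤, bot_ne_top⟩
      eq_bot_or_eq_top := fun P => by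
        let P' : LieSubmodule F L V :=
          { P.restrictScalars F with
            lie_mem := fun {x m} hm => P.smul_mem (⟨_, hmem x⟩ : A) hm }
        rcases eq_bot_or_eq_top P' with h | h
        · left
          rw [eq_bot_iff]
          intro v hv
          have : v ∈ P' := hv
          rw [h] at this
          simpa using this
        · right
          rw [eq_top_iff]
          intro v _
          have : v ∈ P' := h ▸ LieSubmodule.mem_top v
          exact this }
  have hscal := (IsSimpleModule.algebraMap_end_bijective_of_isAlgClosed (A := A) (V := V) F).2
  rw [eq_top_iff]
  rintro r -
  let r' : Module.End (Module.End A V) V :=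
    { r with
      map_smul' := fun f v => by
        obtain ⟨c, rfl⟩ := hscal f
        exact r.map_smul c v }
  obtain ⟨s, hs⟩ := (Module.finite_def.1 (inferInstance : Module.Finite F V))
  obtain ⟨a, ha⟩ := jacobson_density r' s
  have : r = a := LinearMap.ext_on hs fun v hv => ha v hv
  rw [this]
  exact a.2

variable {Γ : Type*} [AddCommGroup Γ]

variable (V) in
/-- The image in `End V` of the grading of the enveloping algebra. -/
def endGrading (𝓛 : Γ → Submodule F L) (g : Γ) : Submodule F (Module.End F V) :=
  (envelopingGrading 𝓛 g).map
    (UniversalEnvelopingAlgebra.lift F (LieModule.toEnd F L V)).toLinearMap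

theorem endGrading_eq_span (𝓛 : Γ → Submodule F L) (g : Γ) :
    endGrading V 𝓛 g = Submodule.span F {a | ∃ l : List (Γ × L), (∀ p ∈ l, p.2 ∈ 𝓛 p.1) ∧
      (l.map Prod.fst).sum = g ∧ (l.map fun p => LieModule.toEnd F L V p.2).prod = a} := by
  rw [endGrading, envelopingGrading, Submodule.map_span]
  congr 1
  ext a
  constructor
  · rintro ⟨_, ⟨l, hl, hg, rfl⟩, rfl⟩
    refine ⟨l, hl, hg, ?_⟩
    simp [map_list_prod, Function.comp_def]
  · rintro ⟨l, hl, hg, rfl⟩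
    refine ⟨_, ⟨l, hl, hg, rfl⟩, ?_⟩
    simp [map_list_prod, Function.comp_def]

theorem toEnd_mem_endGrading {𝓛 : Γ → Submodule F L} {g : Γ} {x : L} (hx : x ∈ 𝓛 g) :
    LieModule.toEnd F L V x ∈ endGrading V 𝓛 g := by
  rw [endGrading_eq_span]
  exact Submodule.subset_span ⟨[(g, x)], by simpa using hx, by simp, by simp⟩

theorem one_mem_endGrading (𝓛 : Γ → Submodule F L) : 1 ∈ endGrading V 𝓛 0 := by
  rw [endGrading_eq_span]
  exact Submodule.subset_span ⟨[], by simp, by simp, by simp⟩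

theorem endGrading_mul_le (𝓛 : Γ → Submodule F L) (g h : Γ) :
    endGrading V 𝓛 g * endGrading V 𝓛 h ≤ endGrading V 𝓛 (g + h) := by
  simp only [endGrading_eq_span]
  rw [Submodule.span_mul_span]
  refine Submodule.span_mono ?_
  rintro _ ⟨_, ⟨l, hl, rfl, rfl⟩, _, ⟨l', hl', rfl, rfl⟩, rfl⟩
  refine ⟨l ++ l', fun p hp => ?_, by simp, by simp⟩
  rcases List.mem_append.1 hp with hp | hp
  exacts [hl p hp, hl' p hp]

/-- To show that `End V`-elements of degree `g` satisfy a property, it suffices to treat `1` and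
left multiplication by homogeneous elements of `L`. -/
theorem endGrading_le_of_mul {𝓛 : Γ → Submodule F L} {𝓢 : Γ → Submodule F (Module.End F V)}
    (h1 : 1 ∈ 𝓢 0)
    (hmul : ∀ g h, ∀ x ∈ 𝓛 g, ∀ r ∈ 𝓢 h, LieModule.toEnd F L V x * r ∈ 𝓢 (g + h)) (g : Γ) :
    endGrading V 𝓛 g ≤ 𝓢 g := by
  rw [endGrading_eq_span, Submodule.span_le]
  rintro _ ⟨l, hl, rfl, rfl⟩
  induction l with
  | nil => simpa using h1
  | cons p l ih =>
    simp only [List.map_cons, List.sum_cons, List.prod_cons]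
    exact hmul _ _ _ (hl p (by simp)) _ (ih fun q hq => hl q (by simp [hq]))

theorem iSup_endGrading_eq_top [IsAlgClosed F] [FiniteDimensional F V]
    [LieModule.IsIrreducible F L V] {𝓛 : Γ → Submodule F L} (h𝓛 : iSup 𝓛 = ⊤) :
    iSup (endGrading V 𝓛) = ⊤ := by
  rw [eq_top_iff]
  rintro r -
  have hr : r ∈ Algebra.adjoin F (Set.range (LieModule.toEnd F L V)) := by
    rw [adjoin_range_toEnd]
    trivial
  induction hr using Algebra.adjoin_induction with
  | mem r hr =>
    obtain ⟨x, rfl⟩ := hr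
    refine Submodule.iSup_induction 𝓛
      (motive := fun x => LieModule.toEnd F L V x ∈ iSup (endGrading V 𝓛))
      (h𝓛 ▸ Submodule.mem_top : x ∈ iSup 𝓛) (fun g x hx => ?_) (by simp) fun x y hx hy => ?_
    · exact Submodule.mem_iSup_of_mem g (toEnd_mem_endGrading hx)
    · rw [map_add]
      exact add_mem hx hy
  | algebraMap c =>
    rw [Algebra.algebraMap_eq_smul_one]
    exact Submodule.smul_mem _ c (Submodule.mem_iSup_of_mem 0 (one_mem_endGrading 𝓛))
  | add r s _ _ hr hs => exact add_mem hr hs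
  | mul r s _ _ hr hs =>
    have h := Submodule.mul_mem_mul hr hs
    simp only [Submodule.iSup_mul, Submodule.mul_iSup] at h
    refine (iSup_le fun g => iSup_le fun h => ?_ :
      ⨆ i, ⨆ j, endGrading V 𝓛 i * endGrading V 𝓛 j ≤ iSup (endGrading V 𝓛)) ?_
    · exact (endGrading_mul_le 𝓛 _ _).trans (le_iSup (endGrading V 𝓛) _)
    · rw [iSup_comm]
      exact h

end Density

section Inertia

variable {F G L : Type*} [Field F] [AddCommGroup G] [DecidableEq G]
  [LieRing L] [LieAlgebra F L] (𝓛 : G → Submodule F L) [GradedLieAlgebra 𝓛]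

theorem charAction_of_mem (χ : AddChar G F) {g : G} {x : L} (hx : x ∈ 𝓛 g) :
    charAction 𝓛 χ x = χ g • x := by
  have h : DirectSum.decomposeLinearEquiv 𝓛 x = DirectSum.lof F G (fun g => 𝓛 g) g ⟨x, hx⟩ :=
    DirectSum.decompose_of_mem 𝓛 hx
  rw [charAction, LinearMap.comp_apply, LinearEquiv.coe_coe, h, DirectSum.toModule_lof]
  rfl

variable (V : Type*) [AddCommGroup V] [Module F V] [LieRingModule L V]

theorem iSup_quotientGrading_eq_top : iSup (quotientGrading 𝓛 V) = ⊤ := by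
  rw [eq_top_iff, ← (DirectSum.Decomposition.isInternal 𝓛).submodule_iSup_eq_top]
  refine iSup_le fun g => le_trans ?_ (le_iSup _ (QuotientAddGroup.mk' (inertiaPerp 𝓛 V) g))
  exact le_iSup (fun k : {k : G // QuotientAddGroup.mk' (inertiaPerp 𝓛 V) k =
    QuotientAddGroup.mk' (inertiaPerp 𝓛 V) g} => 𝓛 k) ⟨g, rfl⟩

variable {V} in
/-- A character in the inertia group, as a function on `G/H_λ`. -/
def quotientChar {χ : AddChar G F} (hχ : χ ∈ inertia 𝓛 V) : AddChar (G ⧸ inertiaPerp 𝓛 V) F :=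
  AddChar.toAddMonoidHomEquiv.symm <| QuotientAddGroup.lift (inertiaPerp 𝓛 V)
    (AddChar.toAddMonoidHomEquiv χ) fun _ hg => hg χ hχ

theorem quotientChar_mk {χ : AddChar G F} (hχ : χ ∈ inertia 𝓛 V) (g : G) :
    quotientChar 𝓛 hχ (QuotientAddGroup.mk' (inertiaPerp 𝓛 V) g) = χ g := rfl

theorem charAction_of_mem_quotientGrading {χ : AddChar G F} (hχ : χ ∈ inertia 𝓛 V)
    {g : G ⧸ inertiaPerp 𝓛 V} {x : L} (hx : x ∈ quotientGrading 𝓛 V g) :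
    charAction 𝓛 χ x = quotientChar 𝓛 hχ g • x := by
  refine Submodule.iSup_induction _
    (motive := fun x => charAction 𝓛 χ x = quotientChar 𝓛 hχ g • x) hx ?_ (by simp)
    (fun x y hx hy => by rw [map_add, hx, hy, smul_add])
  rintro ⟨k, rfl⟩ x hx
  rw [charAction_of_mem 𝓛 χ hx, quotientChar_mk]

variable [LieModule F L V]

theorem conj_of_mem_endGrading {χ : AddChar G F} (hχ : χ ∈ inertia 𝓛 V) {u : V ≃ₗ[F] V}
    (hu : ∀ (x : L) (v : V), u ⁅x, v⁆ = ⁅charAction 𝓛 χ x, u v⁆)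
    {g : G ⧸ inertiaPerp 𝓛 V} {r : Module.End F V}
    (hr : r ∈ endGrading V (quotientGrading 𝓛 V) g) :
    u.conj r = quotientChar 𝓛 hχ g • r := by
  let 𝓢 : G ⧸ inertiaPerp 𝓛 V → Submodule F (Module.End F V) := fun g =>
    LinearMap.eqLocus (u.conj : Module.End F V →ₗ[F] Module.End F V)
      (quotientChar 𝓛 hχ g • LinearMap.id)
  refine endGrading_le_of_mul (𝓢 := 𝓢) ?_ (fun g h x hx r hr => ?_) g hr
  · change u.conj 1 = quotientChar 𝓛 hχ 0 • 1
    rw [AddChar.map_zero_eq_one, one_smul]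
    exact u.conj_id
  · change u.conj r = quotientChar 𝓛 hχ h • r at hr
    change u.conj (_ * r) = quotientChar 𝓛 hχ (g + h) • (_ * r)
    have h1 : u.conj (LieModule.toEnd F L V x) =
        quotientChar 𝓛 hχ g • LieModule.toEnd F L V x := by
      ext v
      simp [LinearEquiv.conj_apply, hu, charAction_of_mem_quotientGrading 𝓛 V hχ hx]
    have h2 : u.conj (LieModule.toEnd F L V x * r) =
        u.conj (LieModule.toEnd F L V x) * u.conj r := LinearEquiv.conj_comp u _ _
    rw [h2, h1, hr, AddChar.map_add_eq_mul, smul_mul_smul_comm]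

theorem isInducedEndGrading_endGrading [IsAlgClosed F] [FiniteDimensional F V]
    [LieModule.IsIrreducible F L V] :
    IsInducedEndGrading (quotientGrading 𝓛 V) (endGrading V (quotientGrading 𝓛 V)) := by
  refine ⟨⟨isGrading_of_eigen (fun a b hab => ?_)
    (iSup_endGrading_eq_top (iSup_quotientGrading_eq_top 𝓛 V)), {
      one_mem := one_mem_endGrading _
      mul_mem := fun g h r s hr hs => endGrading_mul_le _ g h (Submodule.mul_mem_mul hr hs) }⟩,
    fun g a ha => ⟨a, ha, rfl⟩⟩
  obtain ⟨a, rfl⟩ := QuotientAddGroup.mk'_surjective _ a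
  obtain ⟨b, rfl⟩ := QuotientAddGroup.mk'_surjective _ b
  have hab' : -a + b ∉ inertiaPerp 𝓛 V := fun h => hab (QuotientAddGroup.eq.2 h)
  obtain ⟨χ, hχ, hne⟩ : ∃ χ ∈ inertia 𝓛 V, χ (-a + b) ≠ 1 := by
    by_contra! H
    exact hab' H
  obtain ⟨u, hu⟩ := id hχ
  refine ⟨u.conj, quotientChar 𝓛 hχ, fun h => hne ?_,
    fun g r hr => conj_of_mem_endGrading 𝓛 V hχ hu hr⟩
  rw [quotientChar_mk, quotientChar_mk] at h
  rw [AddChar.map_add_eq_mul, ← h, ← AddChar.map_add_eq_mul, neg_add_cancel,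
    AddChar.map_zero_eq_one]

end Inertia

section Link

variable {F L V : Type*} [Field F] [LieRing L] [LieAlgebra F L]
  [AddCommGroup V] [Module F V] [LieRingModule L V] [LieModule F L V]

theorem lie_directSum_eq_toEnd_smul {ι : Type*} (x : L) (w : ⨁ _ : ι, V) :
    ⁅x, w⁆ = LieModule.toEnd F L V x • w := by
  ext i
  rw [DirectSum.lie_module_bracket_apply, DirectSum.smul_apply]
  rfl

variable {Γ : Type*} [AddCommGroup Γ]
  {W : Type*} [AddCommGroup W] [Module F W] [LieRingModule L W]
  [Module (Module.End F V) W] [IsScalarTower F (Module.End F V) W]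

theorem IsGradedSimple.isGradedSimpleModule
    (hlie : ∀ (x : L) (w : W), ⁅x, w⁆ = LieModule.toEnd F L V x • w)
    {𝓛 : Γ → Submodule F L} {𝓦 : Γ → Submodule F W} (h : IsGradedSimple 𝓛 𝓦) :
    IsGradedSimpleModule (endGrading V 𝓛) 𝓦 := by
  refine ⟨⟨h.isGrading, fun g k r w hr hw => ?_⟩, h.nontrivial, fun P hP => ?_⟩
  · let 𝓢 : Γ → Submodule F (Module.End F V) := fun g =>
      { carrier := {r | ∀ k, ∀ w ∈ 𝓦 k, r • w ∈ 𝓦 (g + k)}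
        zero_mem' := fun k w _ => by rw [zero_smul]; exact zero_mem _
        add_mem' := fun ha hb k w hw => by rw [add_smul]; exact add_mem (ha k w hw) (hb k w hw)
        smul_mem' := fun c r hr k w hw => by
          rw [smul_assoc]; exact Submodule.smul_mem _ c (hr k w hw) }
    refine endGrading_le_of_mul (𝓢 := 𝓢) ?_ (fun a b x hx r hr k w hw => ?_) g hr k w hw
    · intro k w hw
      rwa [one_smul, zero_add]
    · rw [mul_smul, ← hlie, add_assoc]
      exact h.lie_mem hx (hr k w hw)
  · let N : LieSubmodule F L W :=
      { P.restrictScalars F with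
        lie_mem := fun {x w} hw => by
          change ⁅x, w⁆ ∈ P
          rw [hlie]
          exact P.smul_mem _ hw }
    rcases h.eq_bot_or_eq_top N hP with H | H
    · left
      refine eq_bot_iff.2 fun w hw => ?_
      have : w ∈ N := hw
      rw [H] at this
      simpa using this
    · right
      refine eq_top_iff.2 fun w _ => ?_
      have : w ∈ N := H ▸ LieSubmodule.mem_top w
      exact this

theorem IsGradedSimpleModule.isGradedSimple [IsAlgClosed F] [FiniteDimensional F V]
    [LieModule.IsIrreducible F L V]
    (hlie : ∀ (x : L) (w : W), ⁅x, w⁆ = LieModule.toEnd F L V x • w)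
    {𝓛 : Γ → Submodule F L} {𝓡 : Γ → Submodule F (Module.End F V)}
    (h𝓡 : IsInducedEndGrading 𝓛 𝓡) {𝓦 : Γ → Submodule F W} (h : IsGradedSimpleModule 𝓡 𝓦) :
    IsGradedSimple 𝓛 𝓦 := by
  refine ⟨⟨h.isGrading, fun g k x w hx hw => ?_⟩, h.nontrivial, fun N hN => ?_⟩
  · rw [hlie]
    refine h.smul_mem ?_ hw
    obtain ⟨a, ha, hax⟩ := toEnd_mem_endGrading (V := V) hx
    rw [← hax]
    exact h𝓡.map_mem g a ha
  · let A : Subalgebra F (Module.End F V) :=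
      { carrier := {r | ∀ w ∈ N, r • w ∈ N}
        mul_mem' := fun ha hb w hw => by rw [mul_smul]; exact ha _ (hb w hw)
        add_mem' := fun ha hb w hw => by rw [add_smul]; exact add_mem (ha w hw) (hb w hw)
        algebraMap_mem' := fun c w hw => by
          rw [algebraMap_smul]; exact N.smul_mem c hw }
    have hA : A = ⊤ := by
      rw [eq_top_iff, ← adjoin_range_toEnd (L := L), Algebra.adjoin_le_iff]
      rintro _ ⟨x, rfl⟩ w hw
      rw [← hlie]
      exact N.lie_mem hw
    let P : Submodule (Module.End F V) W :=
      { N.toSubmodule with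
        smul_mem' := fun r w hw => (hA ▸ Algebra.mem_top : r ∈ A) w hw }
    rcases h.eq_bot_or_eq_top P hN with H | H
    · left
      refine (LieSubmodule.eq_bot_iff N).2 fun w hw => ?_
      have : w ∈ P := hw
      rw [H] at this
      simpa using this
    · right
      refine eq_top_iff.2 fun w _ => ?_
      have : w ∈ P := H ▸ Submodule.mem_top
      exact this

end Link

section EndomorphismGrading

variable {F Γ R M : Type*} [Field F] [AddCommGroup Γ] [Ring R] [Algebra F R]
  [AddCommGroup M] [Module F M] [Module R M] [IsScalarTower F R M]
  {𝓡 : Γ → Submodule F R} {𝓜 : Γ → Submodule F M}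

theorem IsGrading.exists_lift {Δ M N : Type*} [AddCommGroup M] [Module F M] [AddCommGroup N]
    [Module F N] {𝓜 : Δ → Submodule F M} (h : IsGrading 𝓜) (φ : Δ → M →ₗ[F] N) :
    ∃ f : M →ₗ[F] N, ∀ g, ∀ x ∈ 𝓜 g, f x = φ g x := by
  classical
  refine ⟨DirectSum.toModule F Δ N (fun g => φ g ∘ₗ (𝓜 g).subtype) ∘ₗ
    (LinearEquiv.ofBijective (DirectSum.coeLinearMap 𝓜) h.bijective).symm.toLinearMap,
    fun g x hx => ?_⟩
  rw [LinearMap.comp_apply, LinearEquiv.coe_coe, h.ofBijective_symm_of_mem hx,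
    DirectSum.toModule_lof]
  rfl

variable (R) in
/-- The endomorphisms of degree `g` of a graded module, with degrees written on the right. -/
def moduleEndGrading (𝓜 : Γ → Submodule F M) (g : Γ) : Submodule F (Module.End R M) where
  carrier := {f | ∀ h, ∀ m ∈ 𝓜 h, f m ∈ 𝓜 (h + g)}
  zero_mem' := fun _ _ _ => zero_mem _
  add_mem' := fun ha hb h m hm => add_mem (ha h m hm) (hb h m hm)
  smul_mem' := fun c _ hf h m hm => Submodule.smul_mem _ c (hf h m hm)

theorem IsGradedModule.exists_component (h𝓡 : iSup 𝓡 = ⊤) (h : IsGradedModule 𝓡 𝓜)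
    (f : Module.End R M) (g : Γ) : ∃ f' : Module.End R M,
      ∀ k, ∀ m ∈ 𝓜 k, f' m = h.isGrading.proj (k + g) (f m) := by
  obtain ⟨f', hf'⟩ := h.isGrading.exists_lift fun k =>
    h.isGrading.proj (k + g) ∘ₗ f.restrictScalars F
  refine ⟨{ f' with map_smul' := fun r m => ?_ }, hf'⟩
  change f' (r • m) = r • f' m
  refine Submodule.iSup_induction 𝓡 (motive := fun r => f' (r • m) = r • f' m)
    (h𝓡 ▸ Submodule.mem_top : r ∈ iSup 𝓡) (fun a r hr => ?_) (by simp)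
    (fun r s hr hs => by rw [add_smul, map_add, hr, hs, add_smul])
  refine h.isGrading.induction_on (p := fun m => f' (r • m) = r • f' m) m (fun k m hm => ?_)
    (by simp) (fun y z hy hz => by rw [smul_add, map_add, hy, hz, map_add, smul_add])
  rw [hf' _ _ (h.smul_mem hr hm), hf' _ _ hm]
  have := h.isGrading.map_proj h.isGrading (Equiv.addLeft a) (Algebra.lsmul F F M r)
    (fun k x hx => h.smul_mem hr hx) (k + g) (f m)
  simp only [Equiv.coe_addLeft, Algebra.lsmul_coe, ← add_assoc] at this
  simpa using this

theorem IsGradedModule.isGrading_moduleEndGrading [FiniteDimensional F M] (h𝓡 : iSup 𝓡 = ⊤)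
    (h : IsGradedModule 𝓡 𝓜) : IsGrading (moduleEndGrading R 𝓜) := by
  classical
  refine isGrading_of_sum_eq_zero (fun s f hf hs g hg => ?_) (eq_top_iff.2 fun f _ => ?_)
  · ext m
    refine h.isGrading.induction_on (p := fun m => f g m = 0) m (fun k m hm => ?_)
      (map_zero _) (fun y z hy hz => by rw [map_add, hy, hz, add_zero])
    have hsum : ∑ a ∈ s, f a m = 0 := by
      simpa using LinearMap.congr_fun hs m
    have := congrArg (h.isGrading.proj (k + g)) hsum
    rwa [map_sum, map_zero, Finset.sum_eq_single_of_mem g hg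
      (fun b _ hb => h.isGrading.proj_of_mem_ne (hf b k m hm) (by simpa using hb)),
      h.isGrading.proj_of_mem (hf g k m hm)] at this
  · choose c hc using h.exists_component h𝓡 f
    have hfin := WellFoundedGT.finite_ne_bot_of_iSupIndep (isGrading_iff.1 h.isGrading).1
    let T := hfin.toFinset
    have hT : ∀ k, ∀ m ∈ 𝓜 k, m ≠ 0 → k ∈ T := fun k m hm hm0 => by
      simp only [T, Set.Finite.mem_toFinset, Set.mem_ofPred_eq]
      exact fun hk => hm0 (by simpa [hk] using hm)
    let S := (T ×ˢ T).image fun p => p.2 - p.1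
    have hcS : f = ∑ g ∈ S, c g := by
      ext m
      rw [LinearMap.sum_apply]
      refine h.isGrading.induction_on (p := fun m => f m = ∑ g ∈ S, c g m) m (fun k m hm => ?_)
        (by simp) (fun y z hy hz => by simp only [map_add, hy, hz, Finset.sum_add_distrib])
      by_cases hm0 : m = 0
      · simp [hm0]
      rw [Finset.sum_congr rfl fun g _ => hc g k m hm, ← sub_eq_zero]
      refine h.isGrading.eq_zero_of_proj_eq_zero fun a => ?_
      rw [map_sub, map_sum, sub_eq_zero]
      by_cases ha : h.isGrading.proj a (f m) = 0
      · rw [ha]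
        refine (Finset.sum_eq_zero fun g _ => ?_).symm
        by_cases hag : k + g = a
        · rw [hag, ha, map_zero]
        · exact h.isGrading.proj_of_mem_ne (h.isGrading.proj_mem _ _) hag
      · have haS : a - k ∈ S := Finset.mem_image.2 ⟨(k, a), Finset.mem_product.2
          ⟨hT k m hm hm0, hT a _ (h.isGrading.proj_mem a _) ha⟩, rfl⟩
        rw [Finset.sum_eq_single_of_mem _ haS fun g _ hg =>
          h.isGrading.proj_of_mem_ne (h.isGrading.proj_mem _ _)
            (fun hk => hg (by rw [← hk, add_sub_cancel_left])), add_sub_cancel]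
        exact (h.isGrading.proj_of_mem (h.isGrading.proj_mem _ _)).symm
    rw [hcS]
    refine Submodule.sum_mem _ fun g _ => Submodule.mem_iSup_of_mem g fun k m hm => ?_
    rw [hc g k m hm]
    exact h.isGrading.proj_mem _ _

theorem IsGradedSimpleModule.isGradedDivisionAlgebra [FiniteDimensional F M] (h𝓡 : iSup 𝓡 = ⊤)
    (h : IsGradedSimpleModule 𝓡 𝓜) :
    IsGradedDivisionAlgebra fun g => (moduleEndGrading R 𝓜 g).map
      (MulOpposite.opLinearEquiv F : Module.End R M ≃ₗ[F] (Module.End R M)ᵐᵒᵖ).toLinearMap := by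
  have := h.nontrivial
  refine ⟨⟨(h.isGrading_moduleEndGrading h𝓡).map_equiv _, ?_⟩, ?_, inferInstance, ?_⟩
  · refine { one_mem := ⟨1, fun k m hm => ?_, rfl⟩, mul_mem := ?_ }
    · simpa using hm
    · rintro a b _ _ ⟨f, hf, rfl⟩ ⟨f', hf', rfl⟩
      refine ⟨f' * f, fun k m hm => ?_, rfl⟩
      rw [← add_assoc]
      exact hf' _ _ (hf _ _ hm)
  · have : Module.Finite F (Module.End R M) :=
      .of_injective (LinearMap.restrictScalarsₗ F R M M F) <|
        LinearMap.restrictScalars_injective _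
    exact Module.Finite.equiv (MulOpposite.opLinearEquiv F)
  · rintro g _ ⟨f, hf, rfl⟩ hf0
    have hf0' : f ≠ 0 := by
      rintro rfl
      exact hf0 (map_zero _)
    exact ((Module.End.isUnit_iff f).2
      (h.bijective h (Equiv.addRight g) f hf hf0')).op

end EndomorphismGrading

section Representatives

variable {F Γ : Type*} [Field F] [AddCommGroup Γ]

/-- A graded-simple module `M` over a graded simple algebra `R` exhibits the opposite of `End_R(M)`
as a graded division algebra in the class of `R`. -/
theorem IsGradedSimpleModule.representsClass.{u, v, w, r} {F : Type u} {Γ : Type v} [Field F]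
    [AddCommGroup Γ] {R : Type r} {M : Type w} [Ring R] [Algebra F R]
    [FiniteDimensional F R] [IsSimpleRing R] [AddCommGroup M] [Module F M] [Module R M]
    [IsScalarTower F R M] [FiniteDimensional F M]
    {𝓡 : Γ → Submodule F R} {𝓜 : Γ → Submodule F M}
    (h𝓡 : IsAlgebraGrading 𝓡) (h : IsGradedSimpleModule 𝓡 𝓜) :
    RepresentsClass.{u, v, w, r, w} 𝓡 fun g => (moduleEndGrading R 𝓜 g).map
      (MulOpposite.opLinearEquiv F : Module.End R M ≃ₗ[F] (Module.End R M)ᵐᵒᵖ).toLinearMap := by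
  have := h.nontrivial
  have : IsArtinianRing R := IsArtinianRing.of_finite F R
  have : Module.Finite (Module.End R M) M :=
    Module.Finite.of_restrictScalars_finite F (Module.End R M) M
  let _ : Module (Module.End R M)ᵐᵒᵖᵐᵒᵖ M :=
    Module.compHom M (RingEquiv.opOp (Module.End R M)).symm.toRingHom
  have hop : ∀ (f : (Module.End R M)ᵐᵒᵖᵐᵒᵖ) (m : M), f • m = f.unop.unop m := fun _ _ => rfl
  have : IsScalarTower F (Module.End R M)ᵐᵒᵖᵐᵒᵖ M := ⟨fun c f m => rfl⟩
  let φ : R →ₐ[F] Module.End (Module.End R M)ᵐᵒᵖᵐᵒᵖ M :=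
    { toFun := fun r =>
        { toFun := fun m => r • m
          map_add' := smul_add r
          map_smul' := fun f m => (f.unop.unop.map_smul r m).symm }
      map_one' := LinearMap.ext fun m => one_smul R m
      map_mul' := fun r s => LinearMap.ext fun m => mul_smul r s m
      map_zero' := LinearMap.ext fun m => zero_smul R m
      map_add' := fun r s => LinearMap.ext fun m => add_smul r s m
      commutes' := fun c => LinearMap.ext fun m => algebraMap_smul R c m }
  have hφ : Function.Bijective φ := by
    refine ⟨φ.toRingHom.injective, fun f => ?_⟩
    let f' : Module.End (Module.End R M) M :=
      { f with map_smul' := fun a m => f.map_smul (MulOpposite.op (MulOpposite.op a)) m }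
    obtain ⟨r, hr⟩ := Module.Finite.toModuleEnd_moduleEnd_surjective (R := R) (M := M) f'
    exact ⟨r, LinearMap.ext fun m => LinearMap.congr_fun hr m⟩
  refine ⟨h.isGradedDivisionAlgebra h𝓡.isGrading.iSup_eq_top, M, inferInstance, inferInstance,
    inferInstance, inferInstance, 𝓜, AlgEquiv.ofBijective φ hφ,
    ⟨h.isGrading, inferInstance, ?_⟩, fun g a => ⟨fun ha k m hm => h.smul_mem ha hm, fun ha => ?_⟩⟩
  · rintro g k w _ hw ⟨f, hf, rfl⟩
    exact hf g w hw
  · rw [h𝓡.isGrading.mem_iff_proj_eq]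
    refine hφ.1 (LinearMap.ext fun m => ?_)
    change h𝓡.isGrading.proj g a • m = a • m
    refine h.isGrading.induction_on (p := fun m => h𝓡.isGrading.proj g a • m = a • m) m
      (fun k m hm => ?_) (by simp) (fun y z hy hz => by rw [smul_add, hy, hz, smul_add])
    have h₁ := h𝓡.isGrading.map_proj h.isGrading (Equiv.addRight k)
      ((LinearMap.toSpanSingleton R M m).restrictScalars F)
      (fun b r hr => h.smul_mem hr hm) g a
    have h₂ : a • m ∈ 𝓜 (g + k) := ha hm
    have h₃ : h.isGrading.proj (g + k) (a • m) = h𝓡.isGrading.proj g a • m := h₁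
    rw [← h₃, h.isGrading.proj_of_mem h₂]

/-- A graded right module over a graded division algebra `D ≅ M_ℓ(F)` is graded-simple over its
endomorphism algebra. -/
theorem IsGradedRightModule.isGradedSimpleModule {R D W : Type*} [Ring R] [Algebra F R]
    [Ring D] [Algebra F D] [IsSimpleRing D] [AddCommGroup W] [Module F W] [Nontrivial W]
    [Module Dᵐᵒᵖ W] [IsScalarTower F Dᵐᵒᵖ W] [Module R W] [IsScalarTower F R W]
    {𝓡 : Γ → Submodule F R} {𝓓 : Γ → Submodule F D} {𝓦 : Γ → Submodule F W}
    (hD : IsGradedDivisionAlgebra 𝓓) (h : IsGradedRightModule 𝓓 𝓦)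
    (e : R ≃ₐ[F] Module.End Dᵐᵒᵖ W) (hsmul : ∀ (r : R) (w : W), r • w = e r w)
    (he : ∀ (g : Γ) (a : R), a ∈ 𝓡 g ↔ IsHomogeneousEnd 𝓦 g (e a)) :
    IsGradedSimpleModule 𝓡 𝓦 := by
  have := hD.finite
  have : IsArtinianRing D := IsArtinianRing.of_finite F D
  refine ⟨⟨h.isGrading, fun g k r w hr hw => ?_⟩, inferInstance, fun P hP => ?_⟩
  · rw [hsmul]
    exact (he g r).1 hr hw
  by_cases hP0 : P = ⊥
  · exact Or.inl hP0
  right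
  obtain ⟨x, hxP, hx0⟩ := Submodule.exists_mem_ne_zero_of_ne_bot hP0
  obtain ⟨k, hk⟩ := h.isGrading.exists_proj_ne_zero hx0
  have hwP : h.isGrading.proj k x ∈ P := h.isGrading.isGradedSubspace_iff.1 hP k x hxP
  have hwk := h.isGrading.proj_mem k x
  set w := h.isGrading.proj k x
  let ψ : Dᵐᵒᵖ →ₗ[Dᵐᵒᵖ] W := LinearMap.toSpanSingleton Dᵐᵒᵖ W w
  have hψ : Function.Injective ψ := by
    rw [← LinearMap.ker_eq_bot]
    let ψ' : D →ₗ[F] W := ψ.restrictScalars F ∘ₗ (MulOpposite.opLinearEquiv F).toLinearMap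
    have hgr := hD.isGrading.isGradedSubspace_ker h.isGrading (Equiv.addLeft k) ψ'
      fun g d hd => h.smul_mem hwk hd
    refine (Submodule.eq_bot_iff _).2 fun d hd => ?_
    have hd' : d.unop ∈ LinearMap.ker ψ' := hd
    rw [← MulOpposite.unop_eq_zero_iff]
    refine hD.isGrading.eq_zero_of_proj_eq_zero fun g => ?_
    by_contra hg
    have hu := (hD.isUnit (hD.isGrading.proj_mem g d.unop) hg).op
    have hker : MulOpposite.op (hD.isGrading.proj g d.unop) • w = 0 :=
      hD.isGrading.isGradedSubspace_iff.1 hgr g _ hd'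
    exact hk ((hu.smul_eq_zero).1 hker)
  refine eq_top_iff.2 fun y _ => ?_
  obtain ⟨π, hπ⟩ := IsSemisimpleModule.extension_property ψ hψ LinearMap.id
  have hπw : π w = 1 := by
    have h1 : ψ 1 = w := one_smul _ w
    rw [← h1]
    exact LinearMap.congr_fun hπ 1
  have hy : y = e.symm (LinearMap.toSpanSingleton Dᵐᵒᵖ W y ∘ₗ π) • w := by
    rw [hsmul, AlgEquiv.apply_symm_apply, LinearMap.comp_apply, hπw,
      LinearMap.toSpanSingleton_apply, one_smul]
  rw [hy]
  exact P.smul_mem _ hwP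

end Representatives

section EndV

variable {F Γ V : Type*} [Field F] [AddCommGroup Γ] [AddCommGroup V] [Module F V]
  [FiniteDimensional F V] [Nontrivial V]

variable (F V) in
theorem isSimpleRing_end : IsSimpleRing (Module.End F V) := by
  have : Nonempty (Fin (Module.finrank F V)) := ⟨⟨0, Module.finrank_pos⟩⟩
  exact IsSimpleRing.of_ringEquiv (algEquivMatrix (Module.finBasis F V)).symm.toRingEquiv
    inferInstance

theorem finrank_end_self : Module.finrank F (Module.End F V) =
    Module.finrank F V * Module.finrank F V := Module.finrank_linearMap F F V V

theorem IsGradedSimpleModule.exists_equiv_directSum {k l : ℕ}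
    {𝓡 : Γ → Submodule F (Module.End F V)} (h𝓡 : IsAlgebraGrading 𝓡)
    {𝓦 : Γ → Submodule F (⨁ _ : Fin k, V)} {𝓦' : Γ → Submodule F (⨁ _ : Fin l, V)}
    (h : IsGradedSimpleModule 𝓡 𝓦) (h' : IsGradedSimpleModule 𝓡 𝓦') :
    ∃ (s : Γ) (φ : (⨁ _ : Fin k, V) ≃ₗ[Module.End F V] (⨁ _ : Fin l, V)),
      ∀ (g : Γ) (x), φ x ∈ 𝓦' (g + s) ↔ x ∈ 𝓦 g := by
  have := isSimpleRing_end F V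
  have : IsArtinianRing (Module.End F V) := IsArtinianRing.of_finite F _
  have faithful : ∀ (M : Type _) [AddCommGroup M] [Module (Module.End F V) M] [Nontrivial M],
      FaithfulSMul (Module.End F V) M := fun M _ _ _ => ⟨fun {r s} hrs =>
    (Module.toModuleEnd ℤ (S := Module.End F V) M).injective (LinearMap.ext hrs)⟩
  have := h.nontrivial
  have := h'.nontrivial
  have := faithful (⨁ _ : Fin k, V)
  have := faithful (⨁ _ : Fin l, V)
  exact h.exists_equiv h𝓡 h'

variable [IsAlgClosed F]

/-- A finite-dimensional graded-simple module over `End V` is isomorphic to some `V^k`. -/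
theorem IsGradedSimpleModule.exists_directSum {M : Type*} [AddCommGroup M] [Module F M]
    [Module (Module.End F V) M] [IsScalarTower F (Module.End F V) M] [FiniteDimensional F M]
    {𝓡 : Γ → Submodule F (Module.End F V)} {𝓜 : Γ → Submodule F M}
    (h : IsGradedSimpleModule 𝓡 𝓜) : ∃ k : ℕ,
      Module.finrank F M = k * Module.finrank F V ∧
      ∃ 𝓦 : Γ → Submodule F (⨁ _ : Fin k, V), IsGradedSimpleModule 𝓡 𝓦 := by
  have := isSimpleRing_end F V
  have : IsArtinianRing (Module.End F V) := IsArtinianRing.of_finite F _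
  have : Module.Finite (Module.End F V) M :=
    Module.Finite.of_restrictScalars_finite F (Module.End F V) M
  obtain ⟨k, ⟨e⟩⟩ := exists_linearEquiv_fun_of_isSimpleRing (A := Module.End F V) M V
  exact ⟨k, (finrank_end_of_linearEquiv F e).2, _, h.map_equiv
    (e.trans (DirectSum.linearEquivFunOnFintype (Module.End F V) (Fin k) fun _ => V).symm)⟩

theorem RepresentsClass.exists_isGradedSimpleModule {D : Type*} [Ring D] [Algebra F D]
    {𝓡 : Γ → Submodule F (Module.End F V)} {𝓓 : Γ → Submodule F D}
    (h : RepresentsClass 𝓡 𝓓) {l : ℕ} (hl : HasDegree F D l) :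
    ∃ 𝓦 : Γ → Submodule F (⨁ _ : Fin l, V), IsGradedSimpleModule 𝓡 𝓦 := by
  obtain ⟨hD, W, _, _, _, _, 𝓦, e, hW, he⟩ := h
  obtain ⟨eD⟩ := hl
  have := hD.nontrivial
  have := hD.finite
  have := hW.finite
  have hl0 : Nonempty (Fin l) := by
    by_contra hemp
    rw [not_nonempty_iff] at hemp
    exact not_subsingleton D eD.toEquiv.subsingleton
  have : IsSimpleRing D := IsSimpleRing.of_ringEquiv eD.symm.toRingEquiv inferInstance
  have : IsArtinianRing Dᵐᵒᵖ := IsArtinianRing.of_finite F Dᵐᵒᵖ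
  have : Nontrivial W := by
    by_contra hW'
    rw [not_nontrivial_iff_subsingleton] at hW'
    have : Subsingleton (Module.End F V) := e.toEquiv.subsingleton
    exact not_subsingleton (Module.End F V) this
  let _ : Module (Module.End F V) W := Module.compHom W e.toRingEquiv.toRingHom
  have hsmul : ∀ (r : Module.End F V) (w : W), r • w = e r w := fun _ _ => rfl
  have : IsScalarTower F (Module.End F V) W := ⟨fun c r w => by
    rw [hsmul, hsmul, map_smul, LinearMap.smul_apply]⟩
  have hsimple := hW.isGradedSimpleModule hD e hsmul he
  have hdim : Module.finrank F W = Module.finrank F V * l := by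
    refine finrank_eq_mul_of_finrank_end F (A := Dᵐᵒᵖ) ?_ ?_
    · rw [← (MulOpposite.opLinearEquiv F : D ≃ₗ[F] Dᵐᵒᵖ).finrank_eq, eD.toLinearEquiv.finrank_eq]
      simp [Module.finrank_matrix]
    · rw [← e.toLinearEquiv.finrank_eq, finrank_end_self]
  obtain ⟨k, hk, hW'⟩ := hsimple.exists_directSum
  rw [hdim, mul_comm] at hk
  rwa [Nat.eq_of_mul_eq_mul_right Module.finrank_pos hk]

theorem exists_isGradedSimpleModule_directSum {𝓡 : Γ → Submodule F (Module.End F V)}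
    (h𝓡 : IsAlgebraGrading 𝓡) :
    ∃ (k : ℕ) (𝓦 : Γ → Submodule F (⨁ _ : Fin k, V)), IsGradedSimpleModule 𝓡 𝓦 := by
  have : IsArtinianRing (Module.End F V) := IsArtinianRing.of_finite F _
  obtain ⟨I, -, hI⟩ := IsGradedModule.exists_isGradedSimpleModule (M := Module.End F V)
    ⟨h𝓡.isGrading, fun g h r m hr hm => h𝓡.gradedMonoid.mul_mem hr hm⟩
  have : FiniteDimensional F I :=
    FiniteDimensional.of_injective (I.subtype.restrictScalars F) I.subtype_injective
  obtain ⟨k, -, h⟩ := hI.exists_directSum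
  exact ⟨k, h⟩

variable (F V) in
theorem hasDegree_end_directSum (k : ℕ) :
    HasDegree F (Module.End (Module.End F V) (⨁ _ : Fin k, V))ᵐᵒᵖ k := by
  obtain ⟨e⟩ := nonempty_end_algEquiv_matrix (A := Module.End F V) F V k
  let e' := ((DirectSum.linearEquivFunOnFintype (Module.End F V) (Fin k)
    fun _ => V).conjAlgEquiv F).trans e
  exact ⟨(AlgEquiv.op e').trans (Matrix.transposeAlgEquiv (Fin k) F F).symm⟩

end EndV

end GradedLie

end

theorem mainTheorem2 {F G L V : Type*} [Field F] [IsAlgClosed F] [CharZero F]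
    [AddCommGroup G] [DecidableEq G]
    [LieRing L] [LieAlgebra F L] [FiniteDimensional F L] [LieAlgebra.IsSemisimple F L]
    (𝓛 : G → Submodule F L) [GradedLieAlgebra 𝓛]
    [AddCommGroup V] [Module F V] [LieRingModule L V] [LieModule F L V]
    [FiniteDimensional F V] [LieModule.IsIrreducible F L V] :
    -- the graded Schur index of `V` is well defined
    (∃! ℓ : ℕ, GradedLie.IsGradedSchurIndex 𝓛 V ℓ) ∧
    -- `V^k` admits a graded-simple `G/H_λ`-grading iff `k` is the graded Schur index of `V`
    (∀ k : ℕ,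
      (∃ 𝓦 : G ⧸ GradedLie.inertiaPerp 𝓛 V → Submodule F (DirectSum (Fin k) fun _ => V),
        GradedLie.IsGradedSimple (GradedLie.quotientGrading 𝓛 V) 𝓦) ↔
      GradedLie.IsGradedSchurIndex 𝓛 V k) ∧
    -- such a grading is unique up to isomorphism and shift
    (∀ (k : ℕ) (𝓦 𝓦' : G ⧸ GradedLie.inertiaPerp 𝓛 V →
        Submodule F (DirectSum (Fin k) fun _ => V)),
      GradedLie.IsGradedSimple (GradedLie.quotientGrading 𝓛 V) 𝓦 →
      GradedLie.IsGradedSimple (GradedLie.quotientGrading 𝓛 V) 𝓦' →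
      ∃ (s : G ⧸ GradedLie.inertiaPerp 𝓛 V)
        (φ : (DirectSum (Fin k) fun _ => V) ≃ₗ⁅F,L⁆ (DirectSum (Fin k) fun _ => V)),
        ∀ g, (𝓦 g).map (φ : (DirectSum (Fin k) fun _ => V) →ₗ[F] (DirectSum (Fin k) fun _ => V)) =
          𝓦' (g + s)) := by
  have : Nontrivial V := (LieSubmodule.nontrivial_iff F L V).1 inferInstance
  have := GradedLie.isSimpleRing_end F V
  have h𝓡 := GradedLie.isInducedEndGrading_endGrading 𝓛 V
  have hlie (k : ℕ) (x : L) (w : DirectSum (Fin k) fun _ => V) :=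
    GradedLie.lie_directSum_eq_toEnd_smul (F := F) x w
  have hiff : ∀ k : ℕ,
      (∃ 𝓦 : G ⧸ GradedLie.inertiaPerp 𝓛 V → Submodule F (DirectSum (Fin k) fun _ => V),
        GradedLie.IsGradedSimple (GradedLie.quotientGrading 𝓛 V) 𝓦) ↔
      GradedLie.IsGradedSchurIndex 𝓛 V k := by
    refine fun k => ⟨fun ⟨𝓦, h𝓦⟩ => ?_, fun ⟨𝓡, h𝓡', D, _, _, 𝓓, hD, hdeg⟩ => ?_⟩
    · exact ⟨_, h𝓡, _, _, _, _,
        (h𝓦.isGradedSimpleModule (hlie k)).representsClass h𝓡.toIsAlgebraGrading,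
        GradedLie.hasDegree_end_directSum F V k⟩
    · obtain ⟨𝓦, h𝓦⟩ := hD.exists_isGradedSimpleModule hdeg
      exact ⟨𝓦, h𝓦.isGradedSimple (hlie k) h𝓡'⟩
  refine ⟨?_, hiff, fun k 𝓦 𝓦' h h' => ?_⟩
  · obtain ⟨k, 𝓦, h𝓦⟩ := GradedLie.exists_isGradedSimpleModule_directSum h𝓡.toIsAlgebraGrading
    refine ⟨k, (hiff k).1 ⟨𝓦, h𝓦.isGradedSimple (hlie k) h𝓡⟩, fun l hl => ?_⟩
    obtain ⟨𝓦', h𝓦'⟩ := (hiff l).2 hl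
    obtain ⟨-, φ, -⟩ := h𝓦.exists_equiv_directSum h𝓡.toIsAlgebraGrading
      (h𝓦'.isGradedSimpleModule (hlie l))
    have hdim := (φ.restrictScalars F).finrank_eq
    simp only [Module.finrank_directSum, Finset.sum_const, Finset.card_univ, Fintype.card_fin,
      smul_eq_mul] at hdim
    exact (Nat.eq_of_mul_eq_mul_right Module.finrank_pos hdim).symm
  · obtain ⟨s, φ, hφ⟩ := (h.isGradedSimpleModule (hlie k)).exists_equiv_directSum
      h𝓡.toIsAlgebraGrading (h'.isGradedSimpleModule (hlie k))
    refine ⟨s, { φ.restrictScalars F with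
      map_lie' := fun {x w} => ?_ }, fun g => ?_⟩
    · change φ ⁅x, w⁆ = ⁅x, φ w⁆
      rw [hlie, hlie, map_smul]
    · ext y
      constructor
      · rintro ⟨x, hx, rfl⟩
        exact (hφ g x).2 hx
      · intro hy
        refine ⟨φ.symm y, (hφ g _).1 ?_, φ.apply_symm_apply y⟩
        rwa [φ.apply_symm_apply]
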